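/- Let $R$ be an associative ring with identity. A class $\mathcal C$ of left $R$-modules has the \emph{2-out-of-3 property} if, whenever two of the three modules in a short exact sequence $0\to A\to B\to C\to 0$ of left $R$-modules belong to $\mathcal C$, so does the third. A \emph{Vogel class} is a class of left $R$-modules that is closed under direct limits (over directed sets), has the 2-out-of-3 property, and contains all finitely generated projective left $R$-modules. The ring $R$ is \emph{left Vogel-regular} if the only Vogel class is the class of all left $R$-modules, and it is \emph{left coherent} if every finitely generated left ideal of $R$ is finitely presented. For an integer $n\ge 0$, a left $R$-module $F$ is \emph{finitely $n$-presented} if there is an exact sequence $F_n\to F_{n-1}\to\cdots\to F_0\to F\to 0$ with every $F_i$ a finitely generated projective left $R$-module. Let $\mathsf{FP}_n\text{-}\mathsf{Flat}(R^{op})$ be the class of all right $R$-modules $M$ such that $\operatorname{Tor}_1^R(M,F)=0$ for every finitely $n$-presented left $R$-module $F$, and let $$[\mathsf{FP}_n\text{-}\mathsf{Flat}(R^{op})]^{\top_1}=\{N \text{ a left } R\text{-module} : \operatorname{Tor}_1^R(M,N)=0 \text{ for all } M\in \mathsf{FP}_n\text{-}\mathsf{Flat}(R^{op})\}.$$ \textbf{Theorem.}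 Let $R$ be a left Vogel-regular ring. Then the following are equivalent: (i) there is an integer $n\ge 2$ such that the class $[\mathsf{FP}_n\text{-}\mathsf{Flat}(R^{op})]^{\top_1}$ has the 2-out-of-3 property; (ii) $R$ is left coherent. -/

import Mathlib

open CategoryTheory CategoryTheory.Limits

open scoped TensorProduct

universe u

namespace VogelRegular

section Tensor

variable (R : Type u) [Ring R]

/-- The subgroup of `M ⊗ N` (tensor product of abelian groups) generated by the elements
`(m · r) ⊗ n - m ⊗ (r · n)`, where `M` is a right `R`-module, that is, a module over the opposite
ring `Rᵐᵒᵖ`, and `N` is a left `R`-module. -/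
def balancedRelations (M N : Type u) [AddCommGroup M] [Module Rᵐᵒᵖ M]
    [AddCommGroup N] [Module R N] : AddSubgroup (M ⊗[ℤ] N) :=
  AddSubgroup.closure
    {x | ∃ (m : M) (r : R) (n : N), x = (MulOpposite.op r • m) ⊗ₜ[ℤ] n - m ⊗ₜ[ℤ] (r • n)}

/-- The tensor product `M ⊗_R N` of a right module and a left module over a ring `R` that need
not be commutative, as an abelian group. -/
abbrev BalancedTensor (M N : Type u) [AddCommGroup M] [Module Rᵐᵒᵖ M]
    [AddCommGroup N] [Module R N] : Type u :=
  (M ⊗[ℤ] N) ⧸ balancedRelations R M N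

/-- The pure tensor `m ⊗ n` in `M ⊗_R N`. -/
def BalancedTensor.tmul {M N : Type u} [AddCommGroup M] [Module Rᵐᵒᵖ M]
    [AddCommGroup N] [Module R N] (m : M) (n : N) : BalancedTensor R M N :=
  QuotientAddGroup.mk' (balancedRelations R M N) (m ⊗ₜ[ℤ] n)

variable {R}

theorem BalancedTensor.hom_ext {M N : Type u} [AddCommGroup M] [Module Rᵐᵒᵖ M]
    [AddCommGroup N] [Module R N] {A : Type u} [AddCommGroup A]
    {g h : BalancedTensor R M N →+ A}
    (H : ∀ m n, g (BalancedTensor.tmul R m n) = h (BalancedTensor.tmul R m n)) : g = h := by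
  refine QuotientAddGroup.addMonoidHom_ext _ (AddMonoidHom.ext fun x => ?_)
  induction x using TensorProduct.induction_on with
  | zero => simp
  | tmul m n => exact H m n
  | add x y hx hy => rw [map_add, map_add, hx, hy]

/-- The map `M ⊗_R N → M ⊗_R N'`, `m ⊗ n ↦ m ⊗ f n`, induced by an `R`-linear map
`f : N → N'`. -/
def BalancedTensor.lTensor (M : Type u) {N N' : Type u} [AddCommGroup M] [Module Rᵐᵒᵖ M]
    [AddCommGroup N] [Module R N] [AddCommGroup N'] [Module R N'] (f : N →ₗ[R] N') :
    BalancedTensor R M N →+ BalancedTensor R M N' :=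
  QuotientAddGroup.map _ _
    (LinearMap.lTensor M f.toAddMonoidHom.toIntLinearMap).toAddMonoidHom (by
      rw [balancedRelations, AddSubgroup.closure_le]
      rintro _ ⟨m, r, n, rfl⟩
      refine AddSubgroup.subset_closure ⟨m, r, f n, ?_⟩
      simp)

theorem BalancedTensor.lTensor_tmul (M : Type u) {N N' : Type u} [AddCommGroup M]
    [Module Rᵐᵒᵖ M] [AddCommGroup N] [Module R N] [AddCommGroup N'] [Module R N']
    (f : N →ₗ[R] N') (m : M) (n : N) :
    BalancedTensor.lTensor M f (BalancedTensor.tmul R m n) = BalancedTensor.tmul R m (f n) := rfl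

/-- The functor `M ⊗_R -` from left `R`-modules to abelian groups. -/
noncomputable def tensorFunctor (M : ModuleCat.{u} Rᵐᵒᵖ) :
    ModuleCat.{u} R ⥤ AddCommGrpCat.{u} where
  obj N := AddCommGrpCat.of (BalancedTensor R M N)
  map f := AddCommGrpCat.ofHom (BalancedTensor.lTensor M f.hom)
  map_id N := by
    apply AddCommGrpCat.hom_ext
    exact BalancedTensor.hom_ext fun m n => rfl
  map_comp f g := by
    apply AddCommGrpCat.hom_ext
    exact BalancedTensor.hom_ext fun m n => rfl

instance tensorFunctor_additive (M : ModuleCat.{u} Rᵐᵒᵖ) : (tensorFunctor M).Additive where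
  map_add {N N' f g} := by
    apply AddCommGrpCat.hom_ext
    refine BalancedTensor.hom_ext fun m n => ?_
    change BalancedTensor.tmul R m (f.hom n + g.hom n) =
      BalancedTensor.tmul R m (f.hom n) + BalancedTensor.tmul R m (g.hom n)
    simp only [BalancedTensor.tmul, TensorProduct.tmul_add, map_add]

/-- `Tor_i^R(M, N)` for a right module `M` and a left module `N`: the `i`-th left derived functor
of `M ⊗_R -`, evaluated at `N`. -/
noncomputable def Tor (i : ℕ) (M : ModuleCat.{u} Rᵐᵒᵖ) (N : ModuleCat.{u} R) : AddCommGrpCat.{u} :=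
  ((tensorFunctor M).leftDerived i).obj N

end Tensor

section Classes

variable {R : Type u} [Ring R]

/-- `M` is finitely `n`-presented: there is an exact sequence
`F n → F (n - 1) → ⋯ → F 0 → M → 0` with `F i` finitely generated projective for `i ≤ n`.
(The modules `F i` and maps `d i` beyond this range are irrelevant.) -/
def IsFinitelyPresentedOfOrder (n : ℕ) (M : ModuleCat.{u} R) : Prop :=
  ∃ (F : ℕ → ModuleCat.{u} R) (d : ∀ i, F (i + 1) →ₗ[R] F i) (ε : F 0 →ₗ[R] M),
    (∀ i ≤ n, Module.Finite R (F i) ∧ Module.Projective R (F i)) ∧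
    Function.Surjective ε ∧
    (0 < n → Function.Exact (d 0) ε) ∧
    (∀ i, i + 1 < n → Function.Exact (d (i + 1)) (d i))

variable (R) in
/-- The class of `FP_n`-flat right `R`-modules: those `M` with `Tor_1^R(M, F) = 0` for every
finitely `n`-presented left `R`-module `F`. -/
def fpFlatRight (n : ℕ) : ObjectProperty (ModuleCat.{u} Rᵐᵒᵖ) := fun M =>
  ∀ F : ModuleCat.{u} R, IsFinitelyPresentedOfOrder n F → IsZero (Tor 1 M F)

/-- For a class `X` of right `R`-modules, the class of left `R`-modules `N` with
`Tor_1^R(M, N) = 0` for all `M` in `X`. -/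
def torOrthogonal (X : ObjectProperty (ModuleCat.{u} Rᵐᵒᵖ)) : ObjectProperty (ModuleCat.{u} R) :=
  fun N => ∀ M : ModuleCat.{u} Rᵐᵒᵖ, X M → IsZero (Tor 1 M N)

/-- The 2-out-of-3 property in the category of all left `R`-modules: if two of the three modules
in a short exact sequence belong to the class, then so does the third. -/
def HasTwoOutOfThree (C : ObjectProperty (ModuleCat.{u} R)) : Prop :=
  ∀ S : ShortComplex (ModuleCat.{u} R), S.ShortExact →
    (C S.X₁ → C S.X₂ → C S.X₃) ∧ (C S.X₁ → C S.X₃ → C S.X₂) ∧ (C S.X₂ → C S.X₃ → C S.X₁)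

/-- A class is closed under direct limits, that is, colimits indexed by nonempty directed
preordered sets. -/
def IsClosedUnderDirectLimits (C : ObjectProperty (ModuleCat.{u} R)) : Prop :=
  ∀ (J : Type u) [Preorder J] [IsDirectedOrder J] [Nonempty J],
    C.IsClosedUnderColimitsOfShape J

/-- Vogel classes of left `R`-modules. -/
structure IsVogelClass (C : ObjectProperty (ModuleCat.{u} R)) : Prop where
  directLimits : IsClosedUnderDirectLimits C
  twoOutOfThree : HasTwoOutOfThree C
  finiteProjective : ∀ P : ModuleCat.{u} R, Module.Finite R P → Module.Projective R P → C P

variable (R)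

/-- `R` is left Vogel-regular: the only Vogel class is the class of all left `R`-modules. -/
def IsLeftVogelRegular : Prop :=
  ∀ C : ObjectProperty (ModuleCat.{u} R), IsVogelClass C → C = ⊤

/-- `R` is left coherent: every finitely generated left ideal is finitely presented. -/
def IsLeftCoherent : Prop :=
  ∀ I : Ideal R, I.FG → Module.FinitePresentation R I

end Classes

end VogelRegular

/-!
For every class `X` of right modules, `torOrthogonal X` is closed under direct limits and contains
the projective modules. Over a left Vogel-regular ring it therefore has the 2-out-of-3 property only
if it is the class of all modules, and what remains is to show, over any ring and for `n ≥ 2`, that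
every `FP_n`-flat right module is flat if and only if the ring is left coherent.

If every `FP_n`-flat right module is flat, then so is every power `R^ι`: for a finitely
`2`-presented `F = P / K` the module `K` is finitely presented, hence `R^ι ⊗ K = K^ι` embeds into
`P^ι`. Chase's argument now shows that a finitely generated left ideal `I` is finitely presented:
by flatness `R^ι ⊗ I` embeds into `R^ι ⊗ R = R^ι`, so that `R^ι ⊗ I → I^ι` is injective for all `ι`.

Conversely, over a left coherent ring a finitely presented module is finitely `n`-presented for
every `n`, so an `FP_n`-flat module is `FP_1`-flat, and `FP_1`-flat modules are flat over any ring.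
-/

namespace VogelRegular

section DerivedFunctors

universe v v' u' w w'

variable {C : Type u} {D : Type u'} [Category.{v} C] [Category.{v'} D] [Abelian C] [Abelian D]

theorem exact_epi_comp {W X Y Z : C} {f : X ⟶ Y} {g : Y ⟶ Z} {w : f ≫ g = 0}
    (h : (ShortComplex.mk f g w).Exact) (e : W ⟶ X) [Epi e] :
    (ShortComplex.mk (e ≫ f) g (by rw [Category.assoc, w, comp_zero])).Exact := by
  let φ : ShortComplex.mk (e ≫ f) g (by rw [Category.assoc, w, comp_zero]) ⟶ .mk f g w :=
    { τ₁ := e, τ₂ := 𝟙 Y, τ₃ := 𝟙 Z }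
  have : Epi φ.τ₁ := ‹Epi e›
  have : IsIso φ.τ₂ := inferInstanceAs (IsIso (𝟙 Y))
  have : Mono φ.τ₃ := inferInstanceAs (Mono (𝟙 Z))
  exact (ShortComplex.exact_iff_of_epi_of_isIso_of_mono φ).2 h

theorem exact_comp_iff_mono {W X Y Z : C} {f : W ⟶ X} {g : X ⟶ Y} {w : f ≫ g = 0}
    (h : (ShortComplex.mk f g w).Exact) [Epi g] (m : Y ⟶ Z) :
    (ShortComplex.mk f (g ≫ m) (by rw [reassoc_of% w, zero_comp])).Exact ↔ Mono m := by
  have : Mono (cokernel.desc f g w) := (ShortComplex.exact_iff_mono_cokernel_desc _).1 h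
  have : IsIso (cokernel.desc f g w) := isIso_of_mono_of_epi _
  rw [ShortComplex.exact_iff_mono_cokernel_desc, show cokernel.desc f (g ≫ m) _ =
    cokernel.desc f g w ≫ m by ext; simp]
  exact (MorphismProperty.monomorphisms C).cancel_left_of_respectsIso _ m

/-- A chain complex of projectives that is exact in positive degrees, together with an epimorphism
`ε` from its degree `0` term whose kernel is the image of the differential, is a projective
resolution of the target of `ε`. -/
noncomputable def projectiveResolutionOfExact {X : C} (K : ChainComplex C ℕ)
    (hK : ∀ n, Projective (K.X n)) (ε : K.X 0 ⟶ X) (hε : Epi ε) (w : K.d 1 0 ≫ ε = 0)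
    (exact₀ : (ShortComplex.mk (K.d 1 0) ε w).Exact) (exact_succ : ∀ n, K.ExactAt (n + 1)) :
    ProjectiveResolution X where
  complex := K
  projective := hK
  π := (K.toSingle₀Equiv X).symm ⟨ε, w⟩
  quasiIso := ⟨by
    rintro (_ | n)
    · rw [ChainComplex.quasiIsoAt₀_iff,
        ShortComplex.quasiIso_iff_of_zeros' _ (K.shape _ _ (by simp)) rfl rfl]
      have π_f_zero : ((K.toSingle₀Equiv X).symm ⟨ε, w⟩).f 0 = ε :=
        ChainComplex.toSingle₀Equiv_symm_apply_f_zero ε w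
      change (ShortComplex.mk (K.d 1 0) (((K.toSingle₀Equiv X).symm ⟨ε, w⟩).f 0) _).Exact ∧
        Epi (((K.toSingle₀Equiv X).symm ⟨ε, w⟩).f 0)
      simp only [π_f_zero]
      exact ⟨exact₀, hε⟩
    · exact (quasiIsoAt_iff_exactAt' _ _ (ChainComplex.exactAt_succ_single_obj _ _)).2
        (exact_succ n)⟩

/-- The projective resolution `⋯ ⟶ Q₁ ⟶ Q₀ ⟶ X₂ ⟶ X₃` obtained by splicing a projective
resolution `Q` of `X₁` with a short exact sequence `X₁ ⟶ X₂ ⟶ X₃` whose middle term is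
projective. -/
noncomputable def spliceResolution {S : ShortComplex C} (hS : S.ShortExact) [Projective S.X₂]
    (Q : ProjectiveResolution S.X₁) : ProjectiveResolution S.X₃ :=
  let ε : Q.complex.X 0 ⟶ S.X₁ := Q.π.f 0
  have : Epi ε := inferInstanceAs (Epi (Q.π.f 0))
  have w : Q.complex.d 1 0 ≫ ε ≫ S.f = 0 :=
    (Q.complex_d_comp_π_f_zero_assoc S.f).trans zero_comp
  projectiveResolutionOfExact (Q.complex.augment (ε ≫ S.f) w)
    (fun | 0 => ‹Projective S.X₂› | n + 1 => Q.projective n) S.g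
    hS.epi_g _ (exact_epi_comp hS.exact ε) fun n => by
      rw [HomologicalComplex.exactAt_iff' _ (n + 2) (n + 1) n (by simp) (by simp)]
      match n with
      | 0 => exact (exact_comp_iff_mono (g := ε) Q.exact₀ S.f).2 hS.mono_f
      | n + 1 => exact Q.exact_succ n

theorem isZero_leftDerived_one_obj_iff_mono_map [EnoughProjectives C] (F : C ⥤ D) [F.Additive]
    [PreservesFiniteColimits F] {S : ShortComplex C} (hS : S.ShortExact) [Projective S.X₂] :
    IsZero ((F.leftDerived 1).obj S.X₃) ↔ Mono (F.map S.f) := by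
  let Q := ProjectiveResolution.of S.X₁
  let ε : Q.complex.X 0 ⟶ S.X₁ := Q.π.f 0
  have : Epi ε := inferInstanceAs (Epi (Q.π.f 0))
  have exact_map : (ShortComplex.mk (F.map (Q.complex.d 1 0)) (F.map ε) _).Exact :=
    Q.exact₀.map_of_epi_of_preservesCokernel F ‹Epi ε› inferInstance
  rw [((spliceResolution hS Q).isoLeftDerivedObj F 1).isZero_iff,
    ← exact_comp_iff_mono exact_map]
  refine (HomologicalComplex.exactAt_iff_isZero_homology _ _).symm.trans ?_
  rw [HomologicalComplex.exactAt_iff' _ 2 1 0 (by simp) (by simp)]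
  simp_rw [← F.map_comp]
  rfl

theorem isZero_leftDerived_one_obj_of_isColimit [EnoughProjectives C] (F : C ⥤ D) [F.Additive]
    [PreservesFiniteColimits F] {P : C ⥤ C} (ε : P ⟶ 𝟭 C) [∀ X, Projective (P.obj X)]
    [∀ X, Epi (ε.app X)] {J : Type w} [Category.{w'} J] [PreservesColimitsOfShape J P]
    [PreservesColimitsOfShape J F] [HasColimitsOfShape J C] [HasExactColimitsOfShape J C]
    [HasColimitsOfShape J D] [HasExactColimitsOfShape J D] {G : J ⥤ C} {c : Cocone G}
    (hc : IsColimit c) (hG : ∀ j, IsZero ((F.leftDerived 1).obj (G.obj j))) :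
    IsZero ((F.leftDerived 1).obj c.pt) := by
  let π : G ⋙ P ⟶ G := Functor.whiskerLeft G ε
  have epi_π (j : J) : Epi (π.app j) := inferInstanceAs (Epi (ε.app (G.obj j)))
  have : Epi π := NatTrans.epi_of_epi_app π
  let S : ShortComplex (J ⥤ C) := .mk (kernel.ι π) π (kernel.condition π)
  have hS : S.ShortExact := ⟨ShortComplex.exact_kernel π⟩
  have hSj (j : J) : (S.map ((evaluation J C).obj j)).ShortExact :=
    hS.map_of_exact ((evaluation J C).obj j)
  have hK := colimit.isColimit (kernel π)
  have hP : IsColimit (P.mapCocone c) := isColimitOfPreserves P hc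
  let f : (colimit.cocone (kernel π)).pt ⟶ P.obj c.pt := hK.map (P.mapCocone c) (kernel.ι π)
  have hf (j : J) : colimit.ι (kernel π) j ≫ f = (kernel.ι π).app j ≫ P.map (c.ι.app j) :=
    hK.ι_map (P.mapCocone c) (kernel.ι π) j
  let T : ShortComplex C := colim.mapShortComplex S hK (P.mapCocone c) c f (ε.app c.pt) hf
    fun j => ε.naturality (c.ι.app j)
  have hT : T.ShortExact :=
    { exact := colim.exact_mapShortComplex hS.exact hK hP hc _ _ _ _
      mono_f := colim.map_mono' (kernel.ι π) hK hP f hf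
      epi_g := inferInstanceAs (Epi (ε.app c.pt)) }
  have : Projective T.X₂ := inferInstanceAs (Projective (P.obj c.pt))
  refine (isZero_leftDerived_one_obj_iff_mono_map F hT).2 ?_
  let φ : kernel π ⋙ F ⟶ (G ⋙ P) ⋙ F := Functor.whiskerRight (kernel.ι π) F
  have mono_φ (j : J) : Mono (φ.app j) :=
    have : Projective (S.map ((evaluation J C).obj j)).X₂ :=
      inferInstanceAs (Projective (P.obj (G.obj j)))
    (isZero_leftDerived_one_obj_iff_mono_map F (hSj j)).1 (hG j)
  have : Mono φ := NatTrans.mono_of_mono_app φ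
  refine colim.map_mono' φ (isColimitOfPreserves F hK) (isColimitOfPreserves F hP) (F.map f)
    fun j => ?_
  exact (F.map_comp _ _).symm.trans ((congrArg F.map (hf j)).trans (F.map_comp _ _))

end DerivedFunctors

section TensorProduct

variable {R : Type u} [Ring R]

namespace BalancedTensor

variable {M N N' N'' A : Type u} [AddCommGroup M] [Module Rᵐᵒᵖ M] [AddCommGroup N] [Module R N]
  [AddCommGroup N'] [Module R N'] [AddCommGroup N''] [Module R N''] [AddCommGroup A]

theorem tmul_add (m : M) (n n' : N) : tmul R m (n + n') = tmul R m n + tmul R m n' := by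
  simp only [tmul, TensorProduct.tmul_add, map_add]

theorem add_tmul (m m' : M) (n : N) : tmul R (m + m') n = tmul R m n + tmul R m' n := by
  simp only [tmul, TensorProduct.add_tmul, map_add]

theorem op_smul_tmul (r : R) (m : M) (n : N) :
    tmul R (MulOpposite.op r • m) n = tmul R m (r • n) :=
  QuotientAddGroup.eq_iff_sub_mem.2 (AddSubgroup.subset_closure ⟨m, r, n, rfl⟩)

@[elab_as_elim]
theorem induction_on {p : BalancedTensor R M N → Prop} (x : BalancedTensor R M N)
    (zero : p 0) (tmul : ∀ m n, p (tmul R m n)) (add : ∀ x y, p x → p y → p (x + y)) : p x := by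
  obtain ⟨x, rfl⟩ := QuotientAddGroup.mk'_surjective _ x
  induction x using TensorProduct.induction_on with
  | zero => exact zero
  | tmul m n => exact tmul m n
  | add x y hx hy => rw [map_add]; exact add _ _ hx hy

variable (R M N) in
/-- The pure tensor as a biadditive map. -/
def mk : M →+ N →+ BalancedTensor R M N :=
  AddMonoidHom.mk' (fun m => AddMonoidHom.mk' (tmul R m) (tmul_add m))
    fun m m' => AddMonoidHom.ext fun n => add_tmul m m' n

/-- The homomorphism out of `M ⊗_R N` defined by a balanced biadditive map. -/
def lift (φ : M →+ N →+ A) (h : ∀ m (r : R) n, φ (MulOpposite.op r • m) n = φ m (r • n)) :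
    BalancedTensor R M N →+ A :=
  QuotientAddGroup.lift _ (TensorProduct.liftAddHom φ fun z m n => by simp) (by
    rw [balancedRelations, AddSubgroup.closure_le]
    rintro _ ⟨m, r, n, rfl⟩
    simp [h])

theorem lTensor_comp (g : N' →ₗ[R] N'') (f : N →ₗ[R] N') :
    lTensor M (g ∘ₗ f) = (lTensor M g).comp (lTensor M f) :=
  hom_ext fun _ _ => rfl

theorem lTensor_id : lTensor M (LinearMap.id : N →ₗ[R] N) = AddMonoidHom.id _ :=
  hom_ext fun _ _ => rfl

theorem lTensor_injective_of_comp_eq_id {f : N →ₗ[R] N'} {g : N' →ₗ[R] N}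
    (h : g ∘ₗ f = LinearMap.id) : Function.Injective (lTensor M f) :=
  Function.LeftInverse.injective (g := lTensor M g) fun x => by
    rw [← AddMonoidHom.comp_apply, ← lTensor_comp, h, lTensor_id, AddMonoidHom.id_apply]

end BalancedTensor

/-- The left `R`-module structure on `Hom(M, A)` coming from the right `R`-module structure
on `M`. -/
abbrev homModule (R M A : Type u) [Ring R] [AddCommGroup M] [Module Rᵐᵒᵖ M] [AddCommGroup A] :
    Module R (M →+ A) :=
  Module.compHom (M →+ A) (show R →+* Rᵐᵒᵖᵈᵐᵃ from (RingEquiv.opOp R).toRingHom)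

/-- The functor `Hom(M, -)` from abelian groups to left `R`-modules. -/
def homFunctor (M : ModuleCat.{u} Rᵐᵒᵖ) : AddCommGrpCat.{u} ⥤ ModuleCat.{u} R where
  obj A := letI := homModule R M A; ModuleCat.of R (M →+ A)
  map {A B} f :=
    letI := homModule R M A
    letI := homModule R M B
    ModuleCat.ofHom
      { toFun := fun g => f.hom.comp g
        map_add' := fun g h => AddMonoidHom.ext fun m => map_add f.hom (g m) (h m)
        map_smul' := fun _ _ => rfl }

/-- `M ⊗_R -` is left adjoint to `Hom(M, -)`. -/
noncomputable def tensorHomAdjunction (M : ModuleCat.{u} Rᵐᵒᵖ) :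
    tensorFunctor M ⊣ homFunctor M :=
  Adjunction.mkOfHomEquiv
    { homEquiv := fun N A =>
        letI := homModule R M A
        { toFun := fun f => ModuleCat.ofHom (Y := M →+ A)
            { toFun := fun n => f.hom.comp ((BalancedTensor.mk R M N).flip n)
              map_add' := fun n n' => AddMonoidHom.ext fun m =>
                (congrArg f.hom (BalancedTensor.tmul_add m n n')).trans (map_add f.hom _ _)
              map_smul' := fun r n => AddMonoidHom.ext fun m =>
                congrArg f.hom (BalancedTensor.op_smul_tmul r m n).symm }
          invFun := fun g =>
            let g' : N →ₗ[R] (M →+ A) := g.hom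
            AddCommGrpCat.ofHom (BalancedTensor.lift g'.toAddMonoidHom.flip
              fun m r n => (DFunLike.congr_fun (map_smul g' r n) m).symm)
          left_inv := fun f => by
            apply AddCommGrpCat.hom_ext
            exact BalancedTensor.hom_ext fun _ _ => rfl
          right_inv := fun g => rfl }
      homEquiv_naturality_left_symm := fun f g => by
        apply AddCommGrpCat.hom_ext
        exact BalancedTensor.hom_ext fun _ _ => rfl
      homEquiv_naturality_right := fun f g => rfl }

instance (M : ModuleCat.{u} Rᵐᵒᵖ) : (tensorFunctor M).IsLeftAdjoint :=
  (tensorHomAdjunction M).isLeftAdjoint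

section RightExactness

variable {K P N : Type u} [AddCommGroup K] [Module R K] [AddCommGroup P] [Module R P]
  [AddCommGroup N] [Module R N]

theorem BalancedTensor.lTensor_surjective (M : Type u) [AddCommGroup M] [Module Rᵐᵒᵖ M]
    {g : P →ₗ[R] N} (hg : Function.Surjective g) :
    Function.Surjective (BalancedTensor.lTensor M g) := by
  have : Epi (ModuleCat.ofHom g) := (ModuleCat.epi_iff_surjective _).2 hg
  have : Epi ((tensorFunctor (ModuleCat.of Rᵐᵒᵖ M)).map (ModuleCat.ofHom g)) := inferInstance
  exact (AddCommGrpCat.epi_iff_surjective _).1 this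

theorem BalancedTensor.lTensor_exact (M : Type u) [AddCommGroup M] [Module Rᵐᵒᵖ M]
    {f : K →ₗ[R] P} {g : P →ₗ[R] N} (h : Function.Exact f g) (hg : Function.Surjective g) :
    Function.Exact (BalancedTensor.lTensor M f) (BalancedTensor.lTensor M g) := by
  let S : ShortComplex (ModuleCat.{u} R) :=
    .mk (ModuleCat.ofHom f) (ModuleCat.ofHom g) (ModuleCat.hom_ext h.linearMap_comp_eq_zero)
  have hS : S.Exact := (ShortComplex.ShortExact.moduleCat_exact_iff_function_exact S).2 h
  have : Epi S.g := (ModuleCat.epi_iff_surjective _).2 hg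
  exact (ShortComplex.ab_exact_iff_function_exact _).1
    (hS.map_of_epi_of_preservesCokernel (tensorFunctor (ModuleCat.of Rᵐᵒᵖ M)) ‹_› inferInstance)

theorem isZero_tor_one_iff (M : ModuleCat.{u} Rᵐᵒᵖ) {N : ModuleCat.{u} R} [Module.Projective R P]
    {j : K →ₗ[R] P} {g : P →ₗ[R] N} (hj : Function.Injective j) (h : Function.Exact j g)
    (hg : Function.Surjective g) :
    IsZero (Tor 1 M N) ↔ Function.Injective (BalancedTensor.lTensor M j) := by
  let S : ShortComplex (ModuleCat.{u} R) :=
    .mk (ModuleCat.ofHom j) (ModuleCat.ofHom g) (ModuleCat.hom_ext h.linearMap_comp_eq_zero)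
  have hS : S.ShortExact :=
    { exact := (ShortComplex.ShortExact.moduleCat_exact_iff_function_exact S).2 h
      mono_f := (ModuleCat.mono_iff_injective _).2 hj
      epi_g := (ModuleCat.epi_iff_surjective _).2 hg }
  have : Projective S.X₂ := (IsProjective.iff_projective P).1 inferInstance
  exact (isZero_leftDerived_one_obj_iff_mono_map (tensorFunctor M) hS).trans
    (AddCommGrpCat.mono_iff_injective _)

end RightExactness

end TensorProduct

section FinitelyPresentedOfOrder

variable {R : Type u} [Ring R] {M : ModuleCat.{u} R}

theorem IsFinitelyPresentedOfOrder.mono {m n : ℕ} (hmn : m ≤ n)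
    (h : IsFinitelyPresentedOfOrder n M) : IsFinitelyPresentedOfOrder m M := by
  obtain ⟨F, d, ε, hF, hε, exact₀, exact_succ⟩ := h
  exact ⟨F, d, ε, fun i hi => hF i (hi.trans hmn), hε, fun hm => exact₀ (hm.trans_le hmn),
    fun i hi => exact_succ i (hi.trans_le hmn)⟩

theorem isFinitelyPresentedOfOrder_zero_iff :
    IsFinitelyPresentedOfOrder 0 M ↔ Module.Finite R M := by
  refine ⟨fun ⟨F, _, ε, hF, hε, _⟩ => ?_, fun _ => ?_⟩
  · have := (hF 0 le_rfl).1
    exact .of_surjective ε hε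
  · obtain ⟨n, f, hf⟩ := Module.Finite.exists_fin' R M
    exact ⟨fun _ => ModuleCat.of R (Fin n → R), fun _ => 0, f,
      fun _ _ => ⟨inferInstanceAs (Module.Finite R (Fin n → R)),
        inferInstanceAs (Module.Projective R (Fin n → R))⟩, hf, by simp, by simp⟩

theorem isFinitelyPresentedOfOrder_succ_iff {n : ℕ} :
    IsFinitelyPresentedOfOrder (n + 1) M ↔
      ∃ (P : ModuleCat.{u} R) (f : P →ₗ[R] M), Module.Finite R P ∧ Module.Projective R P ∧
        Function.Surjective f ∧
        IsFinitelyPresentedOfOrder n (ModuleCat.of R (LinearMap.ker f)) := by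
  constructor
  · rintro ⟨F, d, ε, hF, hε, exact₀, exact_succ⟩
    replace exact₀ := exact₀ n.succ_pos
    let δ : F 1 →ₗ[R] LinearMap.ker ε := (d 0).codRestrict _ exact₀.apply_apply_eq_zero
    have hδ : Function.Surjective δ := fun ⟨x, hx⟩ =>
      let ⟨y, hy⟩ := (exact₀ x).1 hx
      ⟨y, Subtype.ext hy⟩
    refine ⟨F 0, ε, (hF 0 (by lia)).1, (hF 0 (by lia)).2, hε, fun i => F (i + 1),
      fun i => d (i + 1), δ, fun i hi => hF _ (by lia), hδ, fun hn => ?_,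
      fun i hi => exact_succ _ (by lia)⟩
    exact (Subtype.val_injective.comp_exact_iff_exact (i := (LinearMap.ker ε).subtype)).1
      (exact_succ 0 (by lia))
  · rintro ⟨P, f, _, _, hf, F, d, ε, hF, hε, exact₀, exact_succ⟩
    let F' : ℕ → ModuleCat.{u} R
      | 0 => P
      | i + 1 => F i
    let d' : ∀ i, F' (i + 1) →ₗ[R] F' i
      | 0 => (LinearMap.ker f).subtype ∘ₗ ε
      | i + 1 => d i
    refine ⟨F', d', f, ?_, hf, fun _ => ?_, ?_⟩
    · rintro (_ | i) hi
      · exact ⟨‹_›, ‹_›⟩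
      · exact hF i (by lia)
    · exact (hε.comp_exact_iff_exact (f := (LinearMap.ker f).subtype)).2
        (LinearMap.exact_subtype_ker_map f)
    · rintro (_ | i) hi
      · exact (Subtype.val_injective.comp_exact_iff_exact (i := (LinearMap.ker f).subtype)).2
          (exact₀ (by lia))
      · exact exact_succ i (by lia)

theorem isFinitelyPresentedOfOrder_one_iff :
    IsFinitelyPresentedOfOrder 1 M ↔ Module.FinitePresentation R M := by
  simp only [isFinitelyPresentedOfOrder_succ_iff, isFinitelyPresentedOfOrder_zero_iff]
  constructor
  · rintro ⟨P, f, _, _, hf, hker⟩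
    have := Module.finitePresentation_of_projective R P
    exact Module.finitePresentation_of_surjective f hf (Module.Finite.iff_fg.1 hker)
  · intro h
    obtain ⟨n, f, hf⟩ := Module.Finite.exists_fin' R M
    exact ⟨ModuleCat.of R (Fin n → R), f, inferInstanceAs (Module.Finite R (Fin n → R)),
      inferInstanceAs (Module.Projective R (Fin n → R)), hf,
      Module.Finite.iff_fg.2 (Module.FinitePresentation.fg_ker f hf)⟩

end FinitelyPresentedOfOrder

section PiTensor

namespace BalancedTensor

variable {R : Type u} [Ring R] {ι M K L L' : Type u} [AddCommGroup M] [Module Rᵐᵒᵖ M]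
  [AddCommGroup K] [Module R K] [AddCommGroup L] [Module R L] [AddCommGroup L'] [Module R L']

theorem exists_fg_lTensor_eq (x : BalancedTensor R M L) :
    ∃ Q : Submodule R L, Q.FG ∧ ∃ y, lTensor M Q.subtype y = x := by
  induction x using induction_on with
  | zero => exact ⟨⊥, Submodule.fg_bot, 0, map_zero _⟩
  | tmul m l =>
    exact ⟨R ∙ l, Submodule.fg_span_singleton l,
      tmul R m ⟨l, Submodule.mem_span_singleton_self l⟩, rfl⟩
  | add x x' hx hx' =>
    obtain ⟨Q, hQ, y, rfl⟩ := hx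
    obtain ⟨Q', hQ', y', rfl⟩ := hx'
    refine ⟨Q ⊔ Q', hQ.sup hQ', lTensor M (Submodule.inclusion le_sup_left) y +
      lTensor M (Submodule.inclusion le_sup_right) y', ?_⟩
    rw [map_add, ← AddMonoidHom.comp_apply, ← AddMonoidHom.comp_apply, ← lTensor_comp,
      ← lTensor_comp, Submodule.subtype_comp_inclusion, Submodule.subtype_comp_inclusion]

theorem lTensor_injective_of_fg {f : L →ₗ[R] L'}
    (h : ∀ Q : Submodule R L, Q.FG → Function.Injective (lTensor M (f ∘ₗ Q.subtype))) :
    Function.Injective (lTensor M f) := by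
  refine (injective_iff_map_eq_zero _).2 fun x hx => ?_
  obtain ⟨Q, hQ, y, rfl⟩ := exists_fg_lTensor_eq x
  rw [← AddMonoidHom.comp_apply, ← lTensor_comp] at hx
  rw [(map_eq_zero_iff _ (h Q hQ)).1 hx, map_zero]

variable (R ι L) in
/-- The canonical map `R^ι ⊗_R L → L^ι`, `(rᵢ)ᵢ ⊗ l ↦ (rᵢ l)ᵢ`. -/
def piTensor : BalancedTensor R (ι → R) L →+ (ι → L) :=
  lift
    (AddMonoidHom.mk' (fun x => AddMonoidHom.mk' (fun l i => x i • l)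
      fun l l' => funext fun i => smul_add (x i) l l')
      fun x x' => AddMonoidHom.ext fun l => funext fun i => add_smul (x i) (x' i) l)
    fun x r l => funext fun i => mul_smul (x i) r l

theorem compLeft_comp_piTensor (f : L →ₗ[R] L') :
    (f.toAddMonoidHom.compLeft ι).comp (piTensor R ι L) =
      (piTensor R ι L').comp (lTensor (ι → R) f) :=
  hom_ext fun x l => funext fun i => map_smul f (x i) l

theorem piTensor_bijective_fin (n : ℕ) : Function.Bijective (piTensor R ι (Fin n → R)) := by
  let e (j : Fin n) : Fin n → R := Pi.single j 1
  let inv : (ι → Fin n → R) →+ BalancedTensor R (ι → R) (Fin n → R) :=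
    ∑ j, ((mk R (ι → R) (Fin n → R)).flip (e j)).comp
      ((Pi.evalAddMonoidHom (fun _ : Fin n => R) j).compLeft ι)
  have inv_apply (l : ι → Fin n → R) : inv l = ∑ j, tmul R (fun i => l i j) (e j) :=
    AddMonoidHom.finsetSum_apply ..
  have sum_smul_e (v : Fin n → R) : ∑ j, v j • e j = v := (pi_eq_sum_univ' v).symm
  have left_inv : inv.comp (piTensor R ι (Fin n → R)) = .id _ := hom_ext fun x v =>
    calc inv (piTensor R ι (Fin n → R) (tmul R x v))
      _ = ∑ j, tmul R (MulOpposite.op (v j) • x) (e j) := inv_apply _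
      _ = ∑ j, mk R (ι → R) (Fin n → R) x (v j • e j) := by simp only [op_smul_tmul]; rfl
      _ = tmul R x v := by rw [← map_sum, sum_smul_e]; rfl
  have right_inv (l : ι → Fin n → R) : piTensor R ι (Fin n → R) (inv l) = l := by
    ext1 i
    rw [inv_apply, map_sum, Finset.sum_apply]
    exact sum_smul_e (l i)
  exact Function.bijective_iff_has_inverse.2 ⟨inv, DFunLike.congr_fun left_inv, right_inv⟩

theorem piTensor_surjective_of_surjective {f : L →ₗ[R] L'} (hf : Function.Surjective f)
    (h : Function.Surjective (piTensor R ι L)) : Function.Surjective (piTensor R ι L') := by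
  refine Function.Surjective.of_comp (g := lTensor (ι → R) f) ?_
  rw [← AddMonoidHom.coe_comp, ← compLeft_comp_piTensor]
  exact hf.comp_left.comp h

theorem piTensor_injective_of_lTensor_injective {f : L →ₗ[R] L'}
    (hf : Function.Injective (lTensor (ι → R) f)) (h : Function.Injective (piTensor R ι L')) :
    Function.Injective (piTensor R ι L) := by
  refine Function.Injective.of_comp (f := f.toAddMonoidHom.compLeft ι) ?_
  rw [← AddMonoidHom.coe_comp, compLeft_comp_piTensor]
  exact h.comp hf

theorem lTensor_injective_of_piTensor_injective {f : L →ₗ[R] L'} (hf : Function.Injective f)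
    (h : Function.Injective (piTensor R ι L)) : Function.Injective (lTensor (ι → R) f) := by
  refine Function.Injective.of_comp (f := piTensor R ι L') ?_
  rw [← AddMonoidHom.coe_comp, ← compLeft_comp_piTensor]
  exact hf.comp_left.comp h

section Exact

variable {f : K →ₗ[R] L} {g : L →ₗ[R] L'}

theorem compLeft_exact (h : Function.Exact f g) :
    Function.Exact (f.toAddMonoidHom.compLeft ι) (g.toAddMonoidHom.compLeft ι) := fun x =>
  calc g.toAddMonoidHom.compLeft ι x = 0
    _ ↔ ∀ i, g (x i) = 0 := funext_iff
    _ ↔ ∀ i, ∃ k, f k = x i := forall_congr' fun i => h (x i)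
    _ ↔ ∃ y : ι → K, ∀ i, f (y i) = x i := Classical.skolem
    _ ↔ x ∈ Set.range (f.toAddMonoidHom.compLeft ι) := exists_congr fun _ => funext_iff.symm

theorem piTensor_surjective_of_exact (hf : Function.Injective f) (h : Function.Exact f g)
    (hg : Function.Surjective g) (hL : Function.Surjective (piTensor R ι L))
    (hL' : Function.Injective (piTensor R ι L')) : Function.Surjective (piTensor R ι K) :=
  AddMonoidHom.surjective_of_surjective_of_injective_of_left_exact _ _ _ _ _ _ _
    (compLeft_comp_piTensor f) (compLeft_comp_piTensor g) (lTensor_exact (ι → R) h hg)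
    (compLeft_exact h) hL hL' hf.comp_left

theorem piTensor_injective_of_exact (h : Function.Exact f g) (hg : Function.Surjective g)
    (hK : Function.Surjective (piTensor R ι K)) (hL : Function.Injective (piTensor R ι L)) :
    Function.Injective (piTensor R ι L') :=
  AddMonoidHom.injective_of_surjective_of_injective_of_right_exact _ _ _ _ _ _ _
    (compLeft_comp_piTensor f) (compLeft_comp_piTensor g) (lTensor_exact (ι → R) h hg)
    (compLeft_exact h) hK hL (lTensor_surjective (ι → R) hg)

end Exact

theorem piTensor_surjective [Module.Finite R L] : Function.Surjective (piTensor R ι L) := by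
  obtain ⟨n, p, hp⟩ := Module.Finite.exists_fin' R L
  exact piTensor_surjective_of_surjective hp (piTensor_bijective_fin n).2

theorem finite_of_piTensor_surjective (h : Function.Surjective (piTensor R L L)) :
    Module.Finite R L := by
  obtain ⟨x, hx⟩ := h id
  obtain ⟨Q, hQ, y, rfl⟩ := exists_fg_lTensor_eq x
  have hy (l : L) : (piTensor R L Q y l : L) = l :=
    congrFun ((DFunLike.congr_fun (compLeft_comp_piTensor Q.subtype) y).trans hx) l
  have hQ_top : Q = ⊤ := eq_top_iff.2 fun l _ => hy l ▸ (piTensor R L Q y l).2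
  exact ⟨hQ_top ▸ hQ⟩

theorem piTensor_injective [Module.FinitePresentation R L] :
    Function.Injective (piTensor R ι L) := by
  obtain ⟨n, p, hp⟩ := Module.Finite.exists_fin' R L
  have : Module.Finite R (LinearMap.ker p) :=
    Module.Finite.iff_fg.2 (Module.FinitePresentation.fg_ker p hp)
  exact piTensor_injective_of_exact (LinearMap.exact_subtype_ker_map p) hp piTensor_surjective
    (piTensor_bijective_fin n).1

theorem finitePresentation_of_piTensor_injective [Module.Finite R L]
    (h : ∀ ι : Type u, Function.Injective (piTensor R ι L)) : Module.FinitePresentation R L := by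
  obtain ⟨n, p, hp⟩ := Module.Finite.exists_fin' R L
  have : Module.Finite R (LinearMap.ker p) := finite_of_piTensor_surjective <|
    piTensor_surjective_of_exact Subtype.val_injective (LinearMap.exact_subtype_ker_map p) hp
      (piTensor_bijective_fin n).2 (h _)
  exact Module.finitePresentation_of_surjective p hp (Module.Finite.iff_fg.1 this)

end BalancedTensor

theorem fpFlatRight_pi (R ι : Type u) [Ring R] {n : ℕ} (hn : 2 ≤ n) :
    fpFlatRight R n (ModuleCat.of Rᵐᵒᵖ (ι → R)) := by
  intro F hF
  obtain ⟨P, f, _, _, hf, hker⟩ := isFinitelyPresentedOfOrder_succ_iff.1 (hF.mono hn)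
  have : Module.FinitePresentation R (LinearMap.ker f) := isFinitelyPresentedOfOrder_one_iff.1 hker
  exact (isZero_tor_one_iff _ Subtype.val_injective (LinearMap.exact_subtype_ker_map f) hf).2
    (BalancedTensor.lTensor_injective_of_piTensor_injective Subtype.val_injective
      BalancedTensor.piTensor_injective)

theorem isLeftCoherent_of_isZero_tor_one_pi {R : Type u} [Ring R]
    (h : ∀ (ι : Type u) (N : ModuleCat.{u} R), IsZero (Tor 1 (ModuleCat.of Rᵐᵒᵖ (ι → R)) N)) :
    IsLeftCoherent R := by
  intro I hI
  have : Module.Finite R I := Module.Finite.iff_fg.2 hI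
  refine BalancedTensor.finitePresentation_of_piTensor_injective fun ι => ?_
  exact BalancedTensor.piTensor_injective_of_lTensor_injective
    ((isZero_tor_one_iff _ I.injective_subtype (LinearMap.exact_subtype_mkQ I) I.mkQ_surjective).1
      (h ι (ModuleCat.of R (R ⧸ I)))) BalancedTensor.piTensor_injective

end PiTensor

section Flat

variable {R : Type u} [Ring R]

theorem lTensor_injective_of_fpFlatRight_one {M : ModuleCat.{u} Rᵐᵒᵖ} (hM : fpFlatRight R 1 M)
    {Q P : Type u} [AddCommGroup Q] [Module R Q] [Module.Finite R Q] [AddCommGroup P] [Module R P]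
    [Module.Finite R P] [Module.Projective R P] {i : Q →ₗ[R] P} (hi : Function.Injective i) :
    Function.Injective (BalancedTensor.lTensor M i) := by
  have := Module.finitePresentation_of_projective R P
  have : Module.FinitePresentation R (P ⧸ LinearMap.range i) :=
    Module.finitePresentation_of_surjective _ (Submodule.mkQ_surjective _)
      (by rw [Submodule.ker_mkQ]; exact Module.Finite.iff_fg.1 inferInstance)
  exact (isZero_tor_one_iff M hi (LinearMap.exact_map_mkQ_range i) (Submodule.mkQ_surjective _)).1
    (hM (ModuleCat.of R _) (isFinitelyPresentedOfOrder_one_iff.2 this))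

theorem exists_finite_le_supported {X : Type*} {Q : Submodule R (X →₀ R)} (hQ : Q.FG) :
    ∃ s : Set X, s.Finite ∧ Q ≤ Finsupp.supported R R s := by
  classical
  obtain ⟨S, rfl⟩ := hQ
  refine ⟨S.biUnion Finsupp.support, Finset.finite_toSet _, Submodule.span_le.2 fun v hv => ?_⟩
  exact (Finsupp.mem_supported R v).2 (Finset.coe_subset.2 (Finset.subset_biUnion_of_mem _ hv))

theorem lTensor_finsupp_injective {M : ModuleCat.{u} Rᵐᵒᵖ} (hM : fpFlatRight R 1 M)
    {X K : Type u} [AddCommGroup K] [Module R K] {f : K →ₗ[R] (X →₀ R)}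
    (hf : Function.Injective f) : Function.Injective (BalancedTensor.lTensor M f) := by
  refine BalancedTensor.lTensor_injective_of_fg fun Q hQ => ?_
  obtain ⟨s, hs, hQs⟩ := exists_finite_le_supported (hQ.map f)
  let P := Finsupp.supported R R s
  have : Finite s := hs
  have : Module.Finite R Q := Module.Finite.iff_fg.2 hQ
  have : Module.Finite R P := .equiv (Finsupp.supportedEquivFinsupp s).symm
  have : Module.Projective R P := .of_equiv (Finsupp.supportedEquivFinsupp s).symm
  let i : Q →ₗ[R] P := (f ∘ₗ Q.subtype).codRestrict P fun q => hQs ⟨q, q.2, rfl⟩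
  have subtype_comp_i : P.subtype ∘ₗ i = f ∘ₗ Q.subtype := LinearMap.subtype_comp_codRestrict ..
  have hi : Function.Injective i := fun _ _ h => Subtype.ext (hf (congrArg Subtype.val h))
  classical
  have subtype_injective : Function.Injective (BalancedTensor.lTensor (N := P) M P.subtype) :=
    BalancedTensor.lTensor_injective_of_comp_eq_id (Finsupp.restrictDom_comp_subtype s)
  rw [← subtype_comp_i, BalancedTensor.lTensor_comp (N' := P)]
  exact subtype_injective.comp (lTensor_injective_of_fpFlatRight_one hM hi)

theorem torOrthogonal_fpFlatRight_one : torOrthogonal (fpFlatRight R 1) = ⊤ :=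
  eq_top_iff.2 fun N _ M hM => (isZero_tor_one_iff M (Submodule.injective_subtype _)
    (LinearMap.exact_subtype_ker_map _) (Finsupp.linearCombination_id_surjective R N)).2
      (lTensor_finsupp_injective hM (Submodule.injective_subtype _))

end Flat

section Coherent

variable {R : Type u} [Ring R]

section PseudoCoherent

variable {M N : Type*} [AddCommGroup M] [Module R M] [AddCommGroup N] [Module R N]

variable (R M) in
/-- `M` is pseudo-coherent: its finitely generated submodules are finitely presented. Unlike for a
coherent module, `M` itself need not be finitely generated. -/
def IsPseudoCoherent : Prop :=
  ∀ K : Submodule R M, K.FG → Module.FinitePresentation R K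

theorem IsPseudoCoherent.finitePresentation_of_injective (hN : IsPseudoCoherent R N)
    [Module.Finite R M] {f : M →ₗ[R] N} (hf : Function.Injective f) :
    Module.FinitePresentation R M := by
  have := hN (LinearMap.range f) (Module.Finite.iff_fg.1 inferInstance)
  exact .of_equiv (LinearEquiv.ofInjective f hf).symm

theorem IsPseudoCoherent.of_equiv (hM : IsPseudoCoherent R M) (e : M ≃ₗ[R] N) :
    IsPseudoCoherent R N := fun K hK =>
  have : Module.Finite R K := Module.Finite.iff_fg.2 hK
  hM.finitePresentation_of_injective (f := e.symm.toLinearMap ∘ₗ K.subtype)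
    (e.symm.injective.comp Subtype.val_injective)

theorem IsPseudoCoherent.prod (hM : IsPseudoCoherent R M) (hN : IsPseudoCoherent R N) :
    IsPseudoCoherent R (M × N) := fun K hK => by
  have : Module.Finite R K := Module.Finite.iff_fg.2 hK
  let p : K →ₗ[R] K.map (LinearMap.snd R M N) := (LinearMap.snd R M N).submoduleMap K
  have hp : Function.Surjective p := (LinearMap.snd R M N).submoduleMap_surjective K
  have : Module.FinitePresentation R (K.map (LinearMap.snd R M N)) := hN _ (hK.map _)
  have : Module.Finite R (LinearMap.ker p) :=
    Module.Finite.iff_fg.2 (Module.FinitePresentation.fg_ker p hp)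
  let i : LinearMap.ker p →ₗ[R] M := LinearMap.fst R M N ∘ₗ K.subtype ∘ₗ (LinearMap.ker p).subtype
  have hi : Function.Injective i := fun x y h => by
    have hsnd (z : LinearMap.ker p) : (z : M × N).2 = 0 := congrArg Subtype.val z.2
    exact Subtype.ext (Subtype.ext (Prod.ext h ((hsnd x).trans (hsnd y).symm)))
  have : Module.FinitePresentation R (LinearMap.ker p) :=
    hM.finitePresentation_of_injective (M := LinearMap.ker p) hi
  exact Module.finitePresentation_of_ker p hp

theorem IsPseudoCoherent.of_subsingleton [Subsingleton M] : IsPseudoCoherent R M :=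
  fun K _ => Module.finitePresentation_of_projective R K

end PseudoCoherent

theorem IsLeftCoherent.isPseudoCoherent_pi (hR : IsLeftCoherent R) (n : ℕ) :
    IsPseudoCoherent R (Fin n → R) := by
  induction n with
  | zero => exact .of_subsingleton
  | succ n ih =>
    exact (IsPseudoCoherent.prod hR ih).of_equiv (Fin.consLinearEquiv R fun _ => R)

theorem IsLeftCoherent.isFinitelyPresentedOfOrder (hR : IsLeftCoherent R) (n : ℕ)
    (M : ModuleCat.{u} R) [Module.FinitePresentation R M] : IsFinitelyPresentedOfOrder n M := by
  induction n generalizing M with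
  | zero => exact isFinitelyPresentedOfOrder_zero_iff.2 inferInstance
  | succ n ih =>
    obtain ⟨m, p, hp⟩ := Module.Finite.exists_fin' R M
    have : Module.FinitePresentation R (LinearMap.ker p) :=
      hR.isPseudoCoherent_pi m _ (Module.FinitePresentation.fg_ker p hp)
    exact isFinitelyPresentedOfOrder_succ_iff.2 ⟨ModuleCat.of R (Fin m → R), p,
      inferInstanceAs (Module.Finite R (Fin m → R)),
      inferInstanceAs (Module.Projective R (Fin m → R)), hp, ih (ModuleCat.of R _)⟩

theorem IsLeftCoherent.fpFlatRight_le (hR : IsLeftCoherent R) (n : ℕ) :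
    fpFlatRight R n ≤ fpFlatRight R 1 := fun _ hM F hF =>
  have := isFinitelyPresentedOfOrder_one_iff.1 hF
  hM F (hR.isFinitelyPresentedOfOrder n F)

theorem torOrthogonal_antitone {X Y : ObjectProperty (ModuleCat.{u} Rᵐᵒᵖ)} (h : X ≤ Y) :
    torOrthogonal (R := R) Y ≤ torOrthogonal X :=
  fun _ hN M hM => hN M (h M hM)

theorem torOrthogonal_fpFlatRight_eq_top_iff {n : ℕ} (hn : 2 ≤ n) :
    torOrthogonal (fpFlatRight R n) = ⊤ ↔ IsLeftCoherent R := by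
  refine ⟨fun h => isLeftCoherent_of_isZero_tor_one_pi fun ι N => ?_, fun hR => ?_⟩
  · exact h.ge N trivial _ (fpFlatRight_pi R ι hn)
  · exact eq_top_iff.2 (torOrthogonal_fpFlatRight_one.ge.trans
      (torOrthogonal_antitone (hR.fpFlatRight_le n)))

end Coherent

section Vogel

variable {R : Type u} [Ring R]

theorem torOrthogonal_of_projective (X : ObjectProperty (ModuleCat.{u} Rᵐᵒᵖ)) (P : ModuleCat.{u} R)
    [Module.Projective R P] : torOrthogonal X P := fun M _ =>
  have : Projective P := (IsProjective.iff_projective P).1 inferInstance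
  (tensorFunctor M).isZero_leftDerived_obj_projective_succ 0 P

theorem isZero_tor_one_of_isColimit {J : Type u} [Category.{u} J] [IsFiltered J]
    {G : J ⥤ ModuleCat.{u} R} {c : Cocone G} (hc : IsColimit c) (M : ModuleCat.{u} Rᵐᵒᵖ)
    (hG : ∀ j, IsZero (Tor 1 M (G.obj j))) : IsZero (Tor 1 M c.pt) := by
  let freeCover : ModuleCat.{u} R ⥤ ModuleCat.{u} R := forget _ ⋙ ModuleCat.free R
  let ε : freeCover ⟶ 𝟭 _ := (ModuleCat.adj R).counit
  have (N : ModuleCat.{u} R) : Projective (freeCover.obj N) :=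
    (IsProjective.iff_projective _).1 (inferInstanceAs (Module.Projective R (N →₀ R)))
  have := (ModuleCat.adj R).leftAdjoint_preservesColimits
  exact isZero_leftDerived_one_obj_of_isColimit (tensorFunctor M) ε hc hG

theorem isClosedUnderDirectLimits_torOrthogonal (X : ObjectProperty (ModuleCat.{u} Rᵐᵒᵖ)) :
    IsClosedUnderDirectLimits (torOrthogonal (R := R) X) := fun _ _ _ _ =>
  ⟨fun _ ⟨p⟩ M hM => isZero_tor_one_of_isColimit p.isColimit M fun j => p.prop_diag_obj j M hM⟩

theorem isVogelClass_torOrthogonal {X : ObjectProperty (ModuleCat.{u} Rᵐᵒᵖ)}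
    (h : HasTwoOutOfThree (torOrthogonal (R := R) X)) :
    IsVogelClass (torOrthogonal (R := R) X) where
  directLimits := isClosedUnderDirectLimits_torOrthogonal X
  twoOutOfThree := h
  finiteProjective P _ _ := torOrthogonal_of_projective X P

theorem hasTwoOutOfThree_top : HasTwoOutOfThree (⊤ : ObjectProperty (ModuleCat.{u} R)) :=
  fun _ _ => ⟨fun _ _ => trivial, fun _ _ => trivial, fun _ _ => trivial⟩

theorem IsLeftVogelRegular.hasTwoOutOfThree_torOrthogonal_iff (hR : IsLeftVogelRegular R)
    {X : ObjectProperty (ModuleCat.{u} Rᵐᵒᵖ)} :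
    HasTwoOutOfThree (torOrthogonal (R := R) X) ↔ torOrthogonal (R := R) X = ⊤ :=
  ⟨fun h => hR _ (isVogelClass_torOrthogonal h), fun h => h ▸ hasTwoOutOfThree_top⟩

end Vogel

end VogelRegular

theorem mainTheorem11_general (R : Type u) [Ring R] (hR : VogelRegular.IsLeftVogelRegular R)
    {n : ℕ} (hn : 2 ≤ n) :
    VogelRegular.HasTwoOutOfThree (VogelRegular.torOrthogonal (VogelRegular.fpFlatRight R n)) ↔
      VogelRegular.IsLeftCoherent R :=
  hR.hasTwoOutOfThree_torOrthogonal_iff.trans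
    (VogelRegular.torOrthogonal_fpFlatRight_eq_top_iff hn)

theorem mainTheorem11 (R : Type u) [Ring R] (hR : VogelRegular.IsLeftVogelRegular R) :
    (∃ n : ℕ, 2 ≤ n ∧
      VogelRegular.HasTwoOutOfThree
        (VogelRegular.torOrthogonal (VogelRegular.fpFlatRight R n))) ↔
      VogelRegular.IsLeftCoherent R := by
  exact ⟨fun ⟨_, hn, h⟩ => (mainTheorem11_general R hR hn).1 h,
    fun h => ⟨2, le_rfl, (mainTheorem11_general R hR le_rfl).2 h⟩⟩
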